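/- Let $X$ be a nonempty Tychonoff space that admits a coarser second-countable Tychonoff topology (a second-countable Tychonoff topology on the set $X$ all of whose open sets are open in $X$). Let $C_p(X)$ be the set of continuous functions $X\to\mathbb R$ with the topology of pointwise convergence, and let $\pi(C_p(X))$ be the least cardinality of a $\pi$-base of $C_p(X)$, i.e. of a family of nonempty open sets such that every nonempty open set contains a member of the family. For families $\mathcal A,\mathcal B$ of subsets of a set, in the game $G_1(\mathcal A,\mathcal B)$ player ONE chooses in each round $n\in\omega$ some $A_n\in\mathcal A$ and player TWO answers with a point $b_n\in A_n$; TWO wins if $\{b_n:n\in\omega\}\in\mathcal B$. A strategy for TWO determines $b_n$ from $A_0,\dots,A_n$; a Markov strategy determines $b_n$ from $A_n$ and $n$ only. It is winning if TWO wins every play that follows it. For a space $Y$ let $\mathcal D$ be the family of dense subsets of $Y$ and, for $y\in Y$, let $\Omega_y=\{A\subseteq Y: y\in\overline A\setminus A\text{ or }A=\{y\}\}$. Let $\Omega$ be the family of open $\omega$-covers of $X$, i.e. of families $\mathcal U$ of open subsets of $X$ with $\bigcup\mathcal U=X$ and $X\notin\mathcal U$ such that every finite subset of $X$ is contained in a member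 of $\mathcal U$. Then the following are equivalent: 1. $\pi(C_p(X))=\aleph_0$; 2. TWO has a winning strategy in $G_1(\mathcal D,\mathcal D)$ on $C_p(X)$; 3. for every $f\in C_p(X)$, TWO has a winning strategy in $G_1(\mathcal D,\Omega_f)$ on $C_p(X)$; 4. TWO has a winning strategy in $G_1(\Omega,\Omega)$ on $X$; 5. TWO has a winning Markov strategy in $G_1(\mathcal D,\mathcal D)$ on $C_p(X)$; 6. for every $f\in C_p(X)$, TWO has a winning Markov strategy in $G_1(\mathcal D,\Omega_f)$ on $C_p(X)$; 7. TWO has a winning Markov strategy in $G_1(\Omega,\Omega)$ on $X$; 8. $X$ is countable (finite or countably infinite). -/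

import Mathlib

open Set Topology Cardinal

/-- A strategy for TWO in the selection game `G₁(𝒜, ℬ)` that uses perfect information: in round `n`
it answers ONE's moves `A 0, …, A n ∈ 𝒜` by a point of `A n`. It is winning if, against every
sequence of moves of ONE, the set of all selected points belongs to `ℬ`. -/
def TwoWins {M : Type*} (𝒜 ℬ : Set (Set M)) : Prop :=
  ∃ σ : (n : ℕ) → (Fin (n + 1) → 𝒜) → M,
    (∀ (n : ℕ) (A : Fin (n + 1) → 𝒜), σ n A ∈ (A (Fin.last n) : Set M)) ∧
    ∀ A : ℕ → 𝒜, Set.range (fun n : ℕ => σ n (fun i => A i)) ∈ ℬ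

/-- TWO has a winning Markov strategy in `G₁(𝒜, ℬ)`: one that uses only ONE's latest move and the
round number. -/
def TwoWinsMarkov {M : Type*} (𝒜 ℬ : Set (Set M)) : Prop :=
  ∃ σ : 𝒜 → ℕ → M,
    (∀ (A : 𝒜) (n : ℕ), σ A n ∈ (A : Set M)) ∧
    ∀ A : ℕ → 𝒜, Set.range (fun n : ℕ => σ (A n) n) ∈ ℬ

/-- `𝒟`: the dense subsets of a space. -/
def denseSets (Y : Type*) [TopologicalSpace Y] : Set (Set Y) :=
  {D | Dense D}

/-- `Ω_x`: the sets `A` with `x ∈ closure A \ A`, together with `{x}`. -/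
def omegaAt {Y : Type*} [TopologicalSpace Y] (x : Y) : Set (Set Y) :=
  {A | x ∈ closure A \ A ∨ A = {x}}

/-- `Ω`: the open `ω`-covers of a space. Covers are nontrivial, that is, the whole space is not
a member. -/
def openOmegaCovers (X : Type*) [TopologicalSpace X] : Set (Set (Set X)) :=
  {𝒰 | (∀ U ∈ 𝒰, IsOpen U) ∧ ⋃₀ 𝒰 = Set.univ ∧ Set.univ ∉ 𝒰 ∧
    ∀ F : Set X, F.Finite → ∃ U ∈ 𝒰, F ⊆ U}

/-- A `π`-base of a space. -/
def IsPiBase {Y : Type*} [TopologicalSpace Y] (𝒰 : Set (Set Y)) : Prop :=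
  (∀ U ∈ 𝒰, IsOpen U ∧ U.Nonempty) ∧
    ∀ V : Set Y, IsOpen V → V.Nonempty → ∃ U ∈ 𝒰, U ⊆ V

/-- The `π`-weight of a space: the least cardinality of a `π`-base. -/
noncomputable def piWeight (Y : Type*) [TopologicalSpace Y] : Cardinal :=
  sInf {c | ∃ 𝒰 : Set (Set Y), IsPiBase 𝒰 ∧ #𝒰 = c}

/-- `C_p(X)`: the continuous real-valued functions on `X` with the topology of pointwise
convergence, that is, with the subspace topology from the product `X → ℝ`. -/
abbrev Cp (X : Type*) [TopologicalSpace X] : Type _ :=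
  {f : X → ℝ // Continuous f}

/-!
Countability of `X` is extracted from a winning strategy of TWO by a tree argument
(`TwoWins.countable_of_forall_response`). Fix a position of the game and let `P` be the set of
answers that the strategy can give to ONE's possible next moves. Each move contains its own answer,
so `P` meets every member of `𝒜`.

* For `𝒜 = Ω`, there is a finite `F ⊆ X` such that `P` contains every open `U ≠ X` with `F ⊆ U`:
  otherwise, choosing for each finite `F` such a set `U` outside `P` produces an `ω`-cover that
  misses `P`.
* For `𝒜 = 𝒟` on `C_p(X)`, the complement of `P` is not dense, so `P` contains a nonempty open
  set, hence every function that agrees with some `h` on some finite `F ⊆ X`.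

The coarser second-countable topology gives a countable family of open sets that separates finite
sets from points (`exists_countable_isOpen_separating`). So in both cases countably many
answers in `P` suffice to defeat every point `x ∉ F`: an answer defeats `x` if it is an open set
missing `x`, respectively a function with value `1` at `x`. Following only moves that realize these
answers, one obtains a countable tree of positions. If `x` were outside all the finite sets attached
to its nodes, ONE could always move so that the answer defeats `x`; then the answers do not cover
`x`, respectively stay away from the zero function, and TWO loses. So `X` is the union
of countably many finite sets.

The same interpolation of continuous functions shows that `X` is countable if `C_p(X)` has a
countable `π`-base. Conversely, for countable `X` the space `C_p(X)` is second countable, and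
Markov strategies come from meeting, in round `n`, the `n`-th member of a countable `π`-base,
or covering the `n`-th finite subset of `X`. Since `C_p(X)` has no isolated points, removing `f` from
ONE's dense sets turns a win for `𝒟` into a win for `Ω_f`.
-/

/-! ### Strategies in selection games -/

theorem TwoWinsMarkov.twoWins {M : Type*} {𝒜 ℬ : Set (Set M)} (h : TwoWinsMarkov 𝒜 ℬ) :
    TwoWins 𝒜 ℬ := by
  obtain ⟨σ, hσ, hwin⟩ := h
  exact ⟨fun n A => σ (A (Fin.last n)) n, fun n A => hσ _ n, fun A => hwin A⟩

/-- The tree argument. The set `R x` consists of the answers that are bad for TWO as far as `x` is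
concerned: if all answers lie in `R x`, then TWO loses. If at each position countably many of the
possible answers are enough to be bad for all but countably many `x`, then a winning strategy
for TWO forces `X` to be countable. -/
theorem TwoWins.countable_of_forall_response {M X : Type*} {𝒜 ℬ : Set (Set M)}
    (h : TwoWins 𝒜 ℬ) (R : X → Set M)
    (hR : ∀ x (b : ℕ → M), (∀ n, b n ∈ R x) → Set.range b ∉ ℬ)
    (hP : ∀ P : Set M, (∀ A ∈ 𝒜, (P ∩ A).Nonempty) →
      ∃ F : Set X, F.Countable ∧ ∃ C ⊆ P, C.Countable ∧ ∀ x ∉ F, ∃ c ∈ C, c ∈ R x) :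
    Countable X := by
  obtain ⟨σ, hσ, hwin⟩ := h
  have key : ∀ (n : ℕ) (s : Fin n → 𝒜), ∃ F : Set X, F.Countable ∧ ∃ N : Set 𝒜, N.Countable ∧
      ∀ x ∉ F, ∃ A ∈ N, σ n (Fin.snoc s A : Fin (n + 1) → 𝒜) ∈ R x := by
    intro n s
    obtain ⟨F, hF, C, hCP, hC, hFC⟩ :=
      hP (Set.range fun A : 𝒜 => σ n (Fin.snoc s A : Fin (n + 1) → 𝒜)) (by
        intro A hA
        refine ⟨_, ⟨⟨A, hA⟩, rfl⟩, ?_⟩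
        simpa using hσ n (Fin.snoc s ⟨A, hA⟩ : Fin (n + 1) → 𝒜))
    choose m hm using hCP
    have := hC.to_subtype
    refine ⟨F, hF, Set.range fun c : C => m c.2, Set.countable_range _, fun x hx => ?_⟩
    obtain ⟨c, hc, hcx⟩ := hFC x hx
    refine ⟨m hc, ⟨⟨c, hc⟩, rfl⟩, ?_⟩
    rw [← hm hc] at hcx
    exact hcx
  choose F hF N hN hFN using key
  -- the countable tree of positions reached by moves from the sets `N`
  let T : (n : ℕ) → Set (Fin n → 𝒜) := fun n =>
    Nat.rec (motive := fun n => Set (Fin n → 𝒜)) Set.univ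
      (fun n t => ⋃ s ∈ t, (fun A => (Fin.snoc s A : Fin (n + 1) → 𝒜)) '' N n s) n
  have hT : ∀ n, (T n).Countable := by
    intro n
    induction n with
    | zero => exact Set.to_countable _
    | succ n ih => exact ih.biUnion fun s _ => (hN n s).image _
  have hcount : (⋃ n, ⋃ s ∈ T n, F n s).Countable :=
    Set.countable_iUnion fun n => (hT n).biUnion fun s _ => hF n s
  suffices hall : ∀ x, x ∈ ⋃ n, ⋃ s ∈ T n, F n s by
    exact Set.countable_univ_iff.mp (hcount.mono fun x _ => hall x)
  intro x
  by_contra hx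
  have hx' : ∀ n, ∀ s ∈ T n, x ∉ F n s := by simpa using hx
  -- ONE's move at a position of the tree that makes TWO's answer bad for `x`
  have step : ∀ (n : ℕ) (s : T n), ∃ A : 𝒜, (Fin.snoc s.1 A : Fin (n + 1) → 𝒜) ∈ T (n + 1) ∧
      σ n (Fin.snoc s.1 A : Fin (n + 1) → 𝒜) ∈ R x := by
    intro n s
    obtain ⟨A, hA, hAx⟩ := hFN n s.1 x (hx' n s.1 s.2)
    exact ⟨A, Set.mem_biUnion s.2 ⟨A, hA, rfl⟩, hAx⟩
  choose m hmT hmR using step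
  let H : (n : ℕ) → T n := fun n =>
    Nat.rec (motive := fun n => T n) ⟨Fin.elim0, Set.mem_univ _⟩
      (fun n s => ⟨_, hmT n s⟩) n
  let A : ℕ → 𝒜 := fun n => m n (H n)
  have hH : ∀ n, (H n).1 = fun i : Fin n => A i := by
    intro n
    induction n with
    | zero => exact funext fun i => i.elim0
    | succ n ih =>
      change (Fin.snoc (H n).1 (A n) : Fin (n + 1) → 𝒜) = _
      funext i
      refine Fin.lastCases ?_ (fun j => ?_) i
      · simp
      · simp [ih]
  refine hR x _ (fun n => ?_) (hwin A)
  have h1 : σ n (H (n + 1)).1 ∈ R x := hmR n (H n)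
  rwa [hH (n + 1)] at h1

/-! ### Games with dense sets -/

theorem twoWinsMarkov_dense_of_countable_piBase {Y : Type*} [TopologicalSpace Y] [Nonempty Y]
    {𝒰 : Set (Set Y)} (h𝒰 : IsPiBase 𝒰) (hc : 𝒰.Countable) :
    TwoWinsMarkov (denseSets Y) (denseSets Y) := by
  have hne : 𝒰.Nonempty := by
    obtain ⟨U, hU, -⟩ := h𝒰.2 Set.univ isOpen_univ Set.univ_nonempty
    exact ⟨U, hU⟩
  obtain ⟨u, rfl⟩ := hc.exists_eq_range hne
  have h : ∀ (A : denseSets Y) (n : ℕ), ∃ y, y ∈ u n ∧ y ∈ (A : Set Y) := fun A n => by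
    obtain ⟨ho, hn⟩ := h𝒰.1 (u n) ⟨n, rfl⟩
    exact A.2.inter_open_nonempty _ ho hn
  choose σ hσu hσA using h
  refine ⟨σ, hσA, fun A => dense_iff_inter_open.2 fun V hV hVn => ?_⟩
  obtain ⟨_, ⟨n, rfl⟩, hn⟩ := h𝒰.2 V hV hVn
  exact ⟨_, hn (hσu (A n) n), n, rfl⟩

theorem mem_omegaAt_of_dense {Y : Type*} [TopologicalSpace Y] {y : Y} {A : Set Y}
    (hA : Dense A) (hy : y ∉ A) : A ∈ omegaAt y :=
  Or.inl ⟨hA y, hy⟩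

/-- ONE's dense set `D` without the point `y`, as a legal move. -/
def removePoint {Y : Type*} [TopologicalSpace Y] [T1Space Y] (y : Y) [(𝓝[≠] y).NeBot]
    (D : denseSets Y) : denseSets Y :=
  ⟨D \ {y}, Dense.sdiff_singleton D.2 y⟩

theorem TwoWins.omegaAt_of_dense {Y : Type*} [TopologicalSpace Y] [T1Space Y] (y : Y)
    [(𝓝[≠] y).NeBot] (h : TwoWins (denseSets Y) (denseSets Y)) :
    TwoWins (denseSets Y) (omegaAt y) := by
  obtain ⟨σ, hσ, hwin⟩ := h
  refine ⟨fun n A => σ n fun i => removePoint y (A i),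
    fun n A => (hσ n fun i => removePoint y (A i)).1, fun A => ?_⟩
  refine mem_omegaAt_of_dense (hwin fun n => removePoint y (A n)) ?_
  rintro ⟨n, hn⟩
  exact (hσ n fun i => removePoint y (A i)).2 hn

theorem TwoWinsMarkov.omegaAt_of_dense {Y : Type*} [TopologicalSpace Y] [T1Space Y] (y : Y)
    [(𝓝[≠] y).NeBot] (h : TwoWinsMarkov (denseSets Y) (denseSets Y)) :
    TwoWinsMarkov (denseSets Y) (omegaAt y) := by
  obtain ⟨σ, hσ, hwin⟩ := h
  refine ⟨fun A n => σ (removePoint y A) n, fun A n => (hσ (removePoint y A) n).1, fun A => ?_⟩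
  refine mem_omegaAt_of_dense (hwin fun n => removePoint y (A n)) ?_
  rintro ⟨n, hn⟩
  exact (hσ (removePoint y (A n)) n).2 hn

/-! ### π-weight -/

theorem exists_isPiBase_mk_eq_piWeight (Y : Type*) [TopologicalSpace Y] :
    ∃ 𝒰 : Set (Set Y), IsPiBase 𝒰 ∧ #𝒰 = piWeight Y := by
  have h : IsPiBase {U : Set Y | IsOpen U ∧ U.Nonempty} :=
    ⟨fun _ hU => hU, fun V hV hVn => ⟨V, ⟨hV, hVn⟩, subset_rfl⟩⟩
  exact csInf_mem (s := {c | ∃ 𝒰 : Set (Set Y), IsPiBase 𝒰 ∧ #𝒰 = c}) ⟨_, _, h, rfl⟩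

theorem piWeight_le_aleph0 (Y : Type*) [TopologicalSpace Y] [SecondCountableTopology Y] :
    piWeight Y ≤ ℵ₀ := by
  have hb := TopologicalSpace.isBasis_countableBasis Y
  have h : IsPiBase (TopologicalSpace.countableBasis Y) := by
    refine ⟨fun U hU => ⟨hb.isOpen hU, TopologicalSpace.nonempty_of_mem_countableBasis hU⟩, ?_⟩
    rintro V hV ⟨y, hy⟩
    obtain ⟨U, hU, -, hUV⟩ := hb.exists_subset_of_mem_open hy hV
    exact ⟨U, hU, hUV⟩
  exact (csInf_le' (s := {c | ∃ 𝒰 : Set (Set Y), IsPiBase 𝒰 ∧ #𝒰 = c}) ⟨_, h, rfl⟩).trans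
    (TopologicalSpace.countable_countableBasis Y).le_aleph0

/-- A finite `π`-base of a `T₁` space would yield a finite dense, hence full, set of points. -/
theorem aleph0_le_piWeight (Y : Type*) [TopologicalSpace Y] [T1Space Y] [Infinite Y] :
    ℵ₀ ≤ piWeight Y := by
  obtain ⟨𝒰, h𝒰, hcard⟩ := exists_isPiBase_mk_eq_piWeight Y
  rw [← hcard]
  by_contra hlt
  have hfin : 𝒰.Finite := Cardinal.lt_aleph0_iff_set_finite.1 (not_le.1 hlt)
  choose! p hp using fun U hU => (h𝒰.1 U hU).2
  have hdense : Dense (p '' 𝒰) := dense_iff_inter_open.2 fun V hV hVn => by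
    obtain ⟨U, hU, hUV⟩ := h𝒰.2 V hV hVn
    exact ⟨p U, hUV (hp U hU), U, hU, rfl⟩
  have huniv : p '' 𝒰 = Set.univ := by
    rw [← (hfin.image p).isClosed.closure_eq, hdense.closure_eq]
  exact Set.infinite_univ (huniv ▸ hfin.image p)

/-! ### The space `C_p(X)` -/

section Cp

variable {X : Type*} [TopologicalSpace X]

instance : Nonempty (Cp X) :=
  ⟨⟨fun _ => 0, continuous_const⟩⟩

instance [Countable X] : SecondCountableTopology (Cp X) :=
  Topology.IsInducing.subtypeVal.secondCountableTopology

instance [Nonempty X] : Infinite (Cp X) :=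
  Infinite.of_injective (fun c : ℝ => (⟨fun _ => c, continuous_const⟩ : Cp X)) fun _ _ h =>
    congrFun (congrArg Subtype.val h) (Classical.arbitrary X)

instance [Nonempty X] (f : Cp X) : (𝓝[≠] f).NeBot := by
  refine Filter.neBot_iff.2 fun h => ?_
  have hopen : IsOpen {f} := (isOpen_singleton_iff_punctured_nhds f).2 h
  let φ : ℝ → Cp X := fun c => ⟨fun x => f.1 x + c, f.2.add continuous_const⟩
  have hφ : Continuous φ := Continuous.subtype_mk (by fun_prop) _
  have hpre : φ ⁻¹' {f} = {0} := by
    ext c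
    simp only [Set.mem_preimage, Set.mem_singleton_iff, Subtype.ext_iff, funext_iff, φ]
    simp
  exact not_isOpen_singleton (0 : ℝ) (hpre ▸ hopen.preimage hφ)

/-- Around each of its points, an open subset of `C_p(X)` restricts only finitely many values. -/
theorem Cp.exists_finset_of_isOpen {U : Set (Cp X)} (hU : IsOpen U) {h : Cp X} (hh : h ∈ U) :
    ∃ I : Finset X, ∀ g : Cp X, (∀ x ∈ I, g.1 x = h.1 x) → g ∈ U := by
  obtain ⟨V, hV, rfl⟩ := isOpen_induced_iff.1 hU
  obtain ⟨I, u, hu, hIV⟩ := isOpen_pi_iff.1 hV h.1 hh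
  refine ⟨I, fun g hg => hIV fun x hx => ?_⟩
  rw [hg x hx]
  exact (hu x hx).2

/-- In a completely regular space, a continuous function can be changed to a constant on a closed
set while keeping its values on a finite set of other points. -/
theorem Cp.exists_eqOn_finset_eqOn_const [CompletelyRegularSpace X] (h : Cp X) (I : Finset X)
    {K : Set X} (hK : IsClosed K) (hIK : ∀ x ∈ I, x ∉ K) (r : ℝ) :
    ∃ g : Cp X, (∀ x ∈ I, g.1 x = h.1 x) ∧ ∀ x ∈ K, g.1 x = r := by
  choose! φ hφc hφ0 hφ1 using fun x (hx : x ∉ K) =>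
    CompletelyRegularSpace.completely_regular x K hK hx
  let p : X → ℝ := fun y => ∏ x ∈ I, (φ x y : ℝ)
  have hp : Continuous p :=
    continuous_finsetProd _ fun x hx => continuous_subtype_val.comp (hφc x (hIK x hx))
  refine ⟨⟨fun y => h.1 y + p y * (r - h.1 y),
    h.2.add (hp.mul (continuous_const.sub h.2))⟩, fun x hx => ?_, fun y hy => ?_⟩
  · have : p x = 0 := Finset.prod_eq_zero hx (by rw [hφ0 x (hIK x hx)]; rfl)
    simp [this]
  · have : p y = 1 := Finset.prod_eq_one fun x hx => by
      rw [hφ1 x (hIK x hx) hy]; rfl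
    simp [this]

theorem countable_of_countable_piBase_Cp [T35Space X] {𝒰 : Set (Set (Cp X))} (h𝒰 : IsPiBase 𝒰)
    (hc : 𝒰.Countable) : Countable X := by
  have key : ∀ U ∈ 𝒰, ∃ (h : Cp X) (I : Finset X),
      ∀ g : Cp X, (∀ x ∈ I, g.1 x = h.1 x) → g ∈ U := fun U hU => by
    obtain ⟨ho, h, hh⟩ := h𝒰.1 U hU
    exact ⟨h, Cp.exists_finset_of_isOpen ho hh⟩
  choose! h I hI using key
  refine Set.countable_univ_iff.mp ((hc.biUnion fun U _ => (I U).countable_toSet).mono ?_)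
  intro x _
  by_contra hx
  simp only [Set.mem_iUnion, not_exists] at hx
  have hV : IsOpen {f : Cp X | f.1 x < 1} :=
    isOpen_lt ((continuous_apply x).comp continuous_subtype_val) continuous_const
  obtain ⟨U, hU, hUV⟩ := h𝒰.2 _ hV ⟨⟨fun _ => 0, continuous_const⟩, by simp⟩
  obtain ⟨g, hg, hgx⟩ := Cp.exists_eqOn_finset_eqOn_const (h U) (I U) (isClosed_singleton (x := x))
    (fun y hy hyx => hx U hU (by rw [← Set.mem_singleton_iff.1 hyx]; exact hy)) 1
  have := hUV (hI U hU g hg)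
  simp [hgx x rfl] at this

end Cp

/-! ### Countability of the underlying space -/

theorem exists_countable_isOpen_separating (X : Type*) [TopologicalSpace X] [T1Space X]
    [SecondCountableTopology X] :
    ∃ 𝒱 : Set (Set X), 𝒱.Countable ∧ (∀ U ∈ 𝒱, IsOpen U) ∧
      ∀ (F : Finset X) (x : X), x ∉ F → ∃ U ∈ 𝒱, ↑F ⊆ U ∧ x ∉ U := by
  have hb := TopologicalSpace.isBasis_countableBasis X
  have hbc := TopologicalSpace.countable_countableBasis X
  set b := TopologicalSpace.countableBasis X
  refine ⟨Set.sUnion '' {s | s.Finite ∧ s ⊆ b},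
    (Set.countable_ofPred_finite_subset hbc).image _, ?_, fun F x hx => ?_⟩
  · rintro _ ⟨s, ⟨-, hs⟩, rfl⟩
    exact isOpen_sUnion fun U hU => hb.isOpen (hs hU)
  · have hsep : ∀ y ∈ F, ∃ U ∈ b, y ∈ U ∧ U ⊆ {x}ᶜ := fun y hy =>
      hb.exists_subset_of_mem_open (a := y) (by rintro rfl; exact hx hy) isOpen_compl_singleton
    choose! B hBb hB hBx using hsep
    refine ⟨_, ⟨B '' F, ⟨F.finite_toSet.image B, ?_⟩, rfl⟩, fun y hy => ?_, ?_⟩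
    · rintro _ ⟨y, hy, rfl⟩
      exact hBb y hy
    · exact ⟨B y, ⟨y, hy, rfl⟩, hB y hy⟩
    · rintro ⟨_, ⟨y, hy, rfl⟩, hxy⟩
      exact hBx y hy hxy rfl

theorem countable_of_twoWins_openOmegaCovers {X : Type*} [TopologicalSpace X] {𝒱 : Set (Set X)}
    (h𝒱c : 𝒱.Countable) (h𝒱o : ∀ U ∈ 𝒱, IsOpen U)
    (h𝒱 : ∀ (F : Finset X) (x : X), x ∉ F → ∃ U ∈ 𝒱, ↑F ⊆ U ∧ x ∉ U)
    (h : TwoWins (openOmegaCovers X) (openOmegaCovers X)) : Countable X := by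
  refine h.countable_of_forall_response (fun x => {U | x ∉ U}) (fun x b hb hcov => ?_)
    (fun P hP => ?_)
  · obtain ⟨_, ⟨n, rfl⟩, hn⟩ := hcov.2.2.2 {x} (Set.finite_singleton x)
    exact hb n (hn rfl)
  · obtain ⟨F, hF⟩ : ∃ F : Finset X, ∀ U, IsOpen U → U ≠ Set.univ → ↑F ⊆ U → U ∈ P := by
      by_contra! hcon
      choose u huo hune hFu huP using hcon
      have hmem : Set.range u ∈ openOmegaCovers X := by
        refine ⟨?_, ?_, ?_, fun F hF => ⟨_, ⟨hF.toFinset, rfl⟩, by simpa using hFu hF.toFinset⟩⟩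
        · rintro _ ⟨F, rfl⟩
          exact huo F
        · exact Set.eq_univ_of_forall fun x => ⟨_, ⟨{x}, rfl⟩, hFu {x} (by simp)⟩
        · rintro ⟨F, hF⟩
          exact hune F hF
      obtain ⟨_, hUP, F, rfl⟩ := hP _ hmem
      exact huP F hUP
    refine ⟨F, F.countable_toSet, {U ∈ 𝒱 | U ≠ Set.univ ∧ ↑F ⊆ U},
      fun U hU => hF U (h𝒱o U hU.1) hU.2.1 hU.2.2, h𝒱c.mono fun U hU => hU.1, fun x hx => ?_⟩
    obtain ⟨U, hU, hFU, hxU⟩ := h𝒱 F x hx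
    exact ⟨U, ⟨hU, fun hu => hxU (hu ▸ Set.mem_univ x), hFU⟩, hxU⟩

theorem countable_of_twoWins_omegaAt_zero {X : Type*} [TopologicalSpace X] [T35Space X]
    {𝒱 : Set (Set X)} (h𝒱c : 𝒱.Countable) (h𝒱o : ∀ U ∈ 𝒱, IsOpen U)
    (h𝒱 : ∀ (F : Finset X) (x : X), x ∉ F → ∃ U ∈ 𝒱, ↑F ⊆ U ∧ x ∉ U)
    (h : TwoWins (denseSets (Cp X)) (omegaAt (⟨fun _ => 0, continuous_const⟩ : Cp X))) :
    Countable X := by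
  refine h.countable_of_forall_response (fun x => {g | g.1 x = 1}) (fun x b hb hmem => ?_)
    (fun P hP => ?_)
  · rcases hmem with ⟨hcl, -⟩ | heq
    · have hV : IsOpen {f : Cp X | f.1 x < 1} :=
        isOpen_lt ((continuous_apply x).comp continuous_subtype_val) continuous_const
      obtain ⟨_, hlt, n, rfl⟩ := mem_closure_iff.1 hcl _ hV (by simp)
      exact hlt.ne (hb n)
    · have h0 : b 0 = ⟨fun _ => 0, continuous_const⟩ := by
        rw [← Set.mem_singleton_iff, ← heq]
        exact ⟨0, rfl⟩
      have h1 : (b 0).1 x = 1 := hb 0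
      simp [h0] at h1
  · -- the complement of `P` is not a legal move, so `P` has an interior point
    obtain ⟨f, hf⟩ : (interior P).Nonempty := by
      by_contra hempty
      have hd : Dense Pᶜ :=
        interior_eq_empty_iff_dense_compl.1 (Set.not_nonempty_iff_eq_empty.1 hempty)
      obtain ⟨g, hg, hg'⟩ := hP _ hd
      exact hg' hg
    obtain ⟨F, hF⟩ := Cp.exists_finset_of_isOpen isOpen_interior hf
    have key : ∀ U ∈ {U ∈ 𝒱 | ↑F ⊆ U}, ∃ g : Cp X,
        (∀ x ∈ F, g.1 x = f.1 x) ∧ ∀ x ∈ Uᶜ, g.1 x = 1 := fun U hU =>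
      Cp.exists_eqOn_finset_eqOn_const f F (h𝒱o U hU.1).isClosed_compl
        (fun x hx hxU => hxU (hU.2 hx)) 1
    choose! g hgF hgU using key
    refine ⟨F, F.countable_toSet, g '' {U ∈ 𝒱 | ↑F ⊆ U}, ?_,
      (h𝒱c.mono fun U hU => hU.1).image g, fun x hx => ?_⟩
    · rintro _ ⟨U, hU, rfl⟩
      exact interior_subset (hF _ (hgF U hU))
    · obtain ⟨U, hU, hFU, hxU⟩ := h𝒱 F x hx
      exact ⟨g U, ⟨U, ⟨hU, hFU⟩, rfl⟩, hgU U ⟨hU, hFU⟩ x hxU⟩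

/-- In round `n`, TWO covers the `n`-th finite subset of `X`. -/
theorem twoWinsMarkov_openOmegaCovers {X : Type*} [TopologicalSpace X] [Countable X] :
    TwoWinsMarkov (openOmegaCovers X) (openOmegaCovers X) := by
  obtain ⟨e, he⟩ := exists_surjective_nat (Finset X)
  choose σ hσA hσ using fun (A : openOmegaCovers X) (n : ℕ) =>
    A.2.2.2.2 (e n) (e n).finite_toSet
  have hcov : ∀ (A : ℕ → openOmegaCovers X) (F : Set X), F.Finite →
      ∃ U ∈ Set.range fun n => σ (A n) n, F ⊆ U := fun A F hF => by
    obtain ⟨n, hn⟩ := he hF.toFinset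
    refine ⟨_, ⟨n, rfl⟩, ?_⟩
    simpa [hn] using hσ (A n) n
  refine ⟨σ, hσA, fun A => ⟨?_, ?_, ?_, hcov A⟩⟩
  · rintro _ ⟨n, rfl⟩
    exact (A n).2.1 _ (hσA (A n) n)
  · refine Set.eq_univ_of_forall fun x => ?_
    obtain ⟨U, hU, hxU⟩ := hcov A {x} (Set.finite_singleton x)
    exact ⟨U, hU, hxU rfl⟩
  · rintro ⟨n, hn⟩
    have h1 : σ (A n) n = Set.univ := hn
    exact (A n).2.2.2.1 (h1 ▸ hσA (A n) n)

theorem mainTheorem6 {X : Type*} [τ : TopologicalSpace X] [T35Space X] [Nonempty X]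
    (hX : ∃ t : TopologicalSpace X, τ ≤ t ∧ @T35Space X t ∧ @SecondCountableTopology X t) :
    List.TFAE
      [piWeight (Cp X) = ℵ₀,
       TwoWins (denseSets (Cp X)) (denseSets (Cp X)),
       ∀ f : Cp X, TwoWins (denseSets (Cp X)) (omegaAt f),
       TwoWins (openOmegaCovers X) (openOmegaCovers X),
       TwoWinsMarkov (denseSets (Cp X)) (denseSets (Cp X)),
       ∀ f : Cp X, TwoWinsMarkov (denseSets (Cp X)) (omegaAt f),
       TwoWinsMarkov (openOmegaCovers X) (openOmegaCovers X),
       Countable X] := by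
  obtain ⟨𝒱, h𝒱c, h𝒱o, h𝒱⟩ : ∃ 𝒱 : Set (Set X), 𝒱.Countable ∧ (∀ U ∈ 𝒱, IsOpen U) ∧
      ∀ (F : Finset X) (x : X), x ∉ F → ∃ U ∈ 𝒱, ↑F ⊆ U ∧ x ∉ U := by
    obtain ⟨t, hle, ht, hsc⟩ := hX
    obtain ⟨𝒱, hc, ho, hsep⟩ :=
      @exists_countable_isOpen_separating X t (@T2Space.t1Space X t inferInstance) hsc
    exact ⟨𝒱, hc, fun U hU => hle U (ho U hU), hsep⟩
  have hbase : piWeight (Cp X) = ℵ₀ → ∃ 𝒰 : Set (Set (Cp X)), IsPiBase 𝒰 ∧ 𝒰.Countable := by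
    intro h
    obtain ⟨𝒰, h𝒰, hcard⟩ := exists_isPiBase_mk_eq_piWeight (Cp X)
    exact ⟨𝒰, h𝒰, Cardinal.le_aleph0_iff_set_countable.1 (hcard.trans h).le⟩
  tfae_have 1 → 5 := fun h => by
    obtain ⟨𝒰, h𝒰, hc⟩ := hbase h
    exact twoWinsMarkov_dense_of_countable_piBase h𝒰 hc
  tfae_have 1 → 8 := fun h => by
    obtain ⟨𝒰, h𝒰, hc⟩ := hbase h
    exact countable_of_countable_piBase_Cp h𝒰 hc
  tfae_have 5 → 2 := TwoWinsMarkov.twoWins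
  tfae_have 2 → 3 := fun h f => h.omegaAt_of_dense f
  tfae_have 5 → 6 := fun h f => h.omegaAt_of_dense f
  tfae_have 6 → 3 := fun h f => (h f).twoWins
  tfae_have 3 → 8 := fun h => countable_of_twoWins_omegaAt_zero h𝒱c h𝒱o h𝒱 (h _)
  tfae_have 7 → 4 := TwoWinsMarkov.twoWins
  tfae_have 4 → 8 := countable_of_twoWins_openOmegaCovers h𝒱c h𝒱o h𝒱
  tfae_have 8 → 7 := fun _ => twoWinsMarkov_openOmegaCovers
  tfae_have 8 → 1 := fun _ => (piWeight_le_aleph0 (Cp X)).antisymm (aleph0_le_piWeight (Cp X))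
  tfae_finish
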